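/- For a cumulative distribution function (cdf) $F$ write $F^{\leftarrow}(u)=\inf\{x\in\mathbb{R}:F(x)\ge u\}$, $u\in(0,1)$. For two sequences of real random variables $\{U_n\}$, $\{V_n\}$ with cdfs $F_{U_n}$, $F_{V_n}$, we write, as $n\to\infty$, - $U_n\le_{L_1\text{-ast}}V_n$ if $\displaystyle\lim_{n\to\infty}\int_{\{x\in\mathbb{R}\,:\,F_{U_n}(x)<F_{V_n}(x)\}}|F_{U_n}(x)-F_{V_n}(x)|\,dx=0$; - $U_n\le_{\mathcal{W}_2\text{-ast}}V_n$ if $\displaystyle\lim_{n\to\infty}\int_{\{u\in(0,1)\,:\,F_{U_n}^{\leftarrow}(u)>F_{V_n}^{\leftarrow}(u)\}}\bigl(F_{U_n}^{\leftarrow}(u)-F_{V_n}^{\leftarrow}(u)\bigr)^2\,du=0$. For a sequence $X_1,X_2,\dots$ of random variables let $X_{r:m}$ be the $r$-th smallest of $X_1,\dots,X_m$. For a positive integer $k$, the upper $k$-th record times are $T^{(k)}_1=1$ and $T^{(k)}_{n+1}=\min\{i\in\mathbb{N}: X_{i:i+k-1}>X_{T^{(k)}_n:T^{(k)}_n+k-1}\}$,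 and the upper $k$-th record values are $R^{(k)}_n=X_{T^{(k)}_n:T^{(k)}_n+k-1}$, $n\ge1$. (If the cdf of i.i.d. observations is continuous, these are almost surely defined for all $n$.) **Theorem.** Let $F_X$ and $F_Y$ be two continuous cdfs such that there exists $d\in\mathbb{R}$ with $F_Y(d)<1$ and $F_X(x)\ge F_Y(x)$ for every $x\ge d$. Let $\{X_n:n\in\mathbb{N}\}$ and $\{Y_n:n\in\mathbb{N}\}$ be two sequences of i.i.d. random variables with respective cdfs $F_X$ and $F_Y$, and let $\{R^{(k)}_n\}$ and $\{S^{(k)}_n\}$ be their respective sequences of upper $k$-th record values. Let $X\sim F_X$ and $Y\sim F_Y$. 1. If $E|X|<\infty$ and $E|Y|<\infty$, then $R^{(k)}_n\le_{L_1\text{-ast}}S^{(k)}_n$, as $n\to\infty$, for every integer $k\ge1$. 2. If $E(X^2)<\infty$ and $E(Y^2)<\infty$, then $R^{(k)}_n\le_{\mathcal{W}_2\text{-ast}}S^{(k)}_n$, as $n\to\infty$, for every integer $k\ge1$. -/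

import Mathlib

open MeasureTheory ProbabilityTheory Filter Topology

noncomputable section

namespace AsymptoticOrder

/-- The left-continuous inverse `F^←(u) = inf {x : F x ≥ u}` of a distribution function;
used only for `u ∈ (0,1)`, where the infimum is over a nonempty set bounded below. -/
def quantile (F : ℝ → ℝ) (u : ℝ) : ℝ := sInf {x : ℝ | u ≤ F x}

/-- The distribution function of the real random variable `Z` under `P`. -/
def distFun {Ω : Type*} [MeasurableSpace Ω] (P : Measure Ω) (Z : Ω → ℝ) : ℝ → ℝ :=
  fun x => cdf (P.map Z) x

/-- The `L₁`-asymptotic usual stochastic order `X_t ≤ Y_t`, as `t → ∞`: the integral of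
`|F_{X_t} - F_{Y_t}|` over `{x : F_{X_t} x < F_{Y_t} x}` tends to `0`. The integral takes values
in `[0, ∞]`. Only marginal laws matter, so the processes may live on different spaces. -/
def L1AstLE {ι Ω Ω' : Type*} [Preorder ι] [MeasurableSpace Ω] [MeasurableSpace Ω']
    (P : Measure Ω) (X : ι → Ω → ℝ) (Q : Measure Ω') (Y : ι → Ω' → ℝ) : Prop :=
  Tendsto
    (fun t => ∫⁻ x in {x : ℝ | distFun P (X t) x < distFun Q (Y t) x},
      ENNReal.ofReal |distFun P (X t) x - distFun Q (Y t) x|)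
    atTop (𝓝 0)

/-- The `W₂`-asymptotic usual stochastic order `X_t ≤ Y_t`, as `t → ∞`: the integral of
`(F_{X_t}^← - F_{Y_t}^←)²` over `{u ∈ (0,1) : F_{X_t}^← u > F_{Y_t}^← u}` tends to `0`.
The integral takes values in `[0, ∞]`. -/
def W2AstLE {ι Ω Ω' : Type*} [Preorder ι] [MeasurableSpace Ω] [MeasurableSpace Ω']
    (P : Measure Ω) (X : ι → Ω → ℝ) (Q : Measure Ω') (Y : ι → Ω' → ℝ) : Prop :=
  Tendsto
    (fun t => ∫⁻ u in {u : ℝ | u ∈ Set.Ioo (0 : ℝ) 1 ∧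
        quantile (distFun Q (Y t)) u < quantile (distFun P (X t)) u},
      ENNReal.ofReal ((quantile (distFun P (X t)) u - quantile (distFun Q (Y t)) u) ^ 2))
    atTop (𝓝 0)

/-- The entry at position `r`, counted from `0`, of the nondecreasing rearrangement of
`x 0, …, x (m - 1)`; that is, the `(r + 1)`-th smallest of these `m` numbers
(and `0` if `m ≤ r`). -/
def orderStat (x : ℕ → ℝ) (r m : ℕ) : ℝ :=
  if h : r < m then x (Tuple.sort (fun i : Fin m => x i) ⟨r, h⟩) else 0

/-- The `k`-th largest (for `1 ≤ k`) of the first `i + k` observations `x 0, …, x (i + k - 1)`.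
With observations `x₁, x₂, …` counted from `1` and `i' = i + 1`, this is the order statistic
`x_{i' : i' + k - 1}`. -/
def kthLargest (k : ℕ) (x : ℕ → ℝ) (i : ℕ) : ℝ := orderStat x i (i + k)

/-- Upper `k`-th record times of the sequence of observations `x`; both the times and the
records are counted from `0`, so `recordTime k x n` is `T_{n+1}^{(k)} - 1`. If there is no
further record, the value is the default `0`. -/
def recordTime (k : ℕ) (x : ℕ → ℝ) : ℕ → ℕ
  | 0 => 0
  | n + 1 => sInf {i : ℕ | kthLargest k x (recordTime k x n) < kthLargest k x i}

/-- Upper `k`-th record values: `recordValue k X n` is the random variable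
`R_{n+1}^{(k)} = X_{T : T + k - 1}`, where `T = T_{n+1}^{(k)}`. -/
def recordValue {Ω : Type*} (k : ℕ) (X : ℕ → Ω → ℝ) (n : ℕ) (ω : Ω) : ℝ :=
  kthLargest k (fun i => X i ω) (recordTime k (fun i => X i ω) n)

end AsymptoticOrder

end

noncomputable section

namespace AsymptoticOrder

/-! ### Order statistics and record times of a fixed sequence -/

/-! Records commute with a continuous cdf `F` applied to the observations, which turns them into
uniform ones. Hence the `n`-th record value has cdf `G_n ∘ F`, where the monotone `G_n` depends only
on `k` and `n` (`distFun_recordValue`), and the order of the two cdfs on `[d, ∞)` passes to the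
records.

So the `L₁` integral lives on `(-∞, d)` and is at most `E (d - S_n)⁺`. In the `W₂` integral only
levels `u ≤ F_{S_n}(d)` occur. Choosing `d'` with `F_Y(d) ≤ F_X(d') < 1`, both quantiles are then
bounded, by `d` and `d'`, and the integral is at most twice `E[R_n²; R_n ≤ d'] + E[S_n²; S_n ≤ d]`.

These truncated moments vanish by dominated convergence (`tendsto_lintegral_recordValue`): by
Borel–Cantelli the records almost surely pass every level at which the cdf is below 1, and they
never fall below the first one, the minimum of `k` observations, which supplies the integrable
bound. -/

theorem kthLargest_eq {k : ℕ} (hk : 1 ≤ k) (x : ℕ → ℝ) (i : ℕ) :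
    kthLargest k x i =
      x (Tuple.sort (fun j : Fin (i + k) => x j) ⟨i, by omega⟩) := by
  rw [kthLargest, orderStat, dif_pos (by omega)]

theorem exists_kthLargest_eq {k : ℕ} (hk : 1 ≤ k) (x : ℕ → ℝ) (i : ℕ) :
    ∃ j, j < i + k ∧ kthLargest k x i = x j :=
  ⟨_, Fin.is_lt _, kthLargest_eq hk x i⟩

/-- After sorting, the entries above `c` form a final segment, and exactly `k` positions are at or
beyond `i`. Monotonicity in `i` and measurability follow from this count. -/
theorem lt_kthLargest_iff {k : ℕ} (hk : 1 ≤ k) (x : ℕ → ℝ) (i : ℕ) (c : ℝ) :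
    c < kthLargest k x i ↔ k ≤ ((Finset.range (i + k)).filter (fun j => c < x j)).card := by
  rw [kthLargest_eq hk]
  set f : Fin (i + k) → ℝ := fun j => x j with hf
  have hcard : ((Finset.range (i + k)).filter (fun j => c < x j)).card =
      (Finset.univ.filter (fun j => c < (f ∘ Tuple.sort f) j)).card := by
    rw [Finset.card_filter, Finset.card_filter, Finset.sum_range]
    exact (Equiv.sum_comp (Tuple.sort f) (fun j => if c < f j then 1 else 0)).symm
  have hmono := Tuple.monotone_sort f
  change c < (f ∘ Tuple.sort f) ⟨i, _⟩ ↔ _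
  rw [hcard]
  generalize f ∘ Tuple.sort f = g at hmono
  constructor
  · intro h
    have hsub : Finset.Ici (⟨i, by omega⟩ : Fin (i + k)) ⊆
        Finset.univ.filter (fun j => c < g j) := by
      intro j hj
      simpa using h.trans_le (hmono (Finset.mem_Ici.1 hj))
    have := Finset.card_le_card hsub
    rw [Fin.card_Ici] at this
    simpa using this
  · intro h
    by_contra hc
    have hsub : Finset.univ.filter (fun j => c < g j) ⊆
        Finset.Ioi (⟨i, by omega⟩ : Fin (i + k)) := by
      intro j hj
      rw [Finset.mem_Ioi]
      by_contra hle
      exact hc ((Finset.mem_filter.1 hj).2.trans_le (hmono (not_lt.1 hle)))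
    have := Finset.card_le_card hsub
    rw [Fin.card_Ioi] at this
    simp only at this
    omega

theorem kthLargest_mono {k : ℕ} (hk : 1 ≤ k) (x : ℕ → ℝ) : Monotone (kthLargest k x) := by
  intro i j hij
  refine le_of_forall_lt fun c hc => ?_
  rw [lt_kthLargest_iff hk] at hc ⊢
  refine hc.trans (Finset.card_le_card (Finset.filter_subset_filter _ ?_))
  exact Finset.range_subset_range.2 (by omega)

theorem kthLargest_comp {k : ℕ} (hk : 1 ≤ k) {F : ℝ → ℝ} (hF : Monotone F) (x : ℕ → ℝ) (i : ℕ) :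
    kthLargest k (fun j => F (x j)) i = F (kthLargest k x i) := by
  rw [kthLargest_eq hk, kthLargest_eq hk]
  have h := Tuple.comp_sort_eq_comp_iff_monotone (f := fun j : Fin (i + k) => F (x j))
    (σ := Tuple.sort (fun j : Fin (i + k) => x j))
  have h' := h.2 (hF.comp (Tuple.monotone_sort (fun j : Fin (i + k) => x j)))
  exact (congrFun h' ⟨i, by omega⟩).symm

theorem exists_lt_kthLargest {k : ℕ} (hk : 1 ≤ k) {x : ℕ → ℝ} {c : ℝ}
    (h : ∃ᶠ j in atTop, c < x j) : ∃ i, c < kthLargest k x i := by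
  obtain ⟨s, hs, hcard⟩ := (Nat.frequently_atTop_iff_infinite.1 h).exists_subset_card_eq k
  obtain ⟨m, hm⟩ := s.exists_nat_subset_range
  refine ⟨m, (lt_kthLargest_iff hk x m c).2 ?_⟩
  rw [← hcard]
  refine Finset.card_le_card fun j hj => Finset.mem_filter.2 ⟨?_, hs hj⟩
  have := Finset.mem_range.1 (hm hj)
  exact Finset.mem_range.2 (by omega)

/-- The `k`-th record value number `n`, as a function of the sequence of observations. -/
def recordFn (k n : ℕ) (x : ℕ → ℝ) : ℝ := kthLargest k x (recordTime k x n)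

theorem exists_recordFn_eq {k : ℕ} (hk : 1 ≤ k) (n : ℕ) (x : ℕ → ℝ) :
    ∃ j, recordFn k n x = x j := by
  obtain ⟨j, -, hj⟩ := exists_kthLargest_eq hk x (recordTime k x n)
  exact ⟨j, hj⟩

/-- `F` may have flat pieces; `hx` says that it increases strictly up to each observation, which is
enough to preserve strict comparisons between observations. -/
theorem recordTime_comp {k : ℕ} (hk : 1 ≤ k) {F : ℝ → ℝ} (hF : Monotone F) {x : ℕ → ℝ}
    (hx : ∀ j, ∀ y < x j, F y < F (x j)) (n : ℕ) :
    recordTime k (fun j => F (x j)) n = recordTime k x n := by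
  induction n with
  | zero => rfl
  | succ n ih =>
    simp only [recordTime, ih, kthLargest_comp hk hF]
    congr 1
    ext i
    refine ⟨fun h => hF.reflect_lt h, fun h => ?_⟩
    obtain ⟨j, -, hj⟩ := exists_kthLargest_eq hk x i
    simp only [Set.mem_ofPred_eq] at h ⊢
    rw [hj] at h ⊢
    exact hx j _ h

theorem recordFn_comp {k : ℕ} (hk : 1 ≤ k) {F : ℝ → ℝ} (hF : Monotone F) {x : ℕ → ℝ}
    (hx : ∀ j, ∀ y < x j, F y < F (x j)) (n : ℕ) :
    recordFn k n (fun j => F (x j)) = F (recordFn k n x) := by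
  rw [recordFn, recordTime_comp hk hF hx, kthLargest_comp hk hF, recordFn]

theorem recordFn_zero_le {k : ℕ} (hk : 1 ≤ k) (n : ℕ) (x : ℕ → ℝ) :
    recordFn k 0 x ≤ recordFn k n x :=
  kthLargest_mono hk x (Nat.zero_le _)

/-- Every observation is exceeded infinitely often, so a further record always exists and the
default `0` is never used. -/
theorem le_recordTime {k : ℕ} (hk : 1 ≤ k) {x : ℕ → ℝ}
    (hx : ∀ j, ∃ᶠ l in atTop, x j < x l) (n : ℕ) : n ≤ recordTime k x n := by
  induction n with
  | zero => exact Nat.zero_le _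
  | succ n ih =>
    obtain ⟨j, -, hj⟩ := exists_kthLargest_eq hk x (recordTime k x n)
    have hne : {i | kthLargest k x (recordTime k x n) < kthLargest k x i}.Nonempty :=
      exists_lt_kthLargest hk (hj ▸ hx j)
    have hlt := (kthLargest_mono hk x).reflect_lt (Nat.sInf_mem hne)
    exact Nat.succ_le_of_lt (ih.trans_lt hlt)

theorem eventually_lt_recordFn {k : ℕ} (hk : 1 ≤ k) {x : ℕ → ℝ}
    (hx : ∀ j, ∃ᶠ l in atTop, x j < x l) {c : ℝ} (hc : ∃ᶠ l in atTop, c < x l) :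
    ∀ᶠ n in atTop, c < recordFn k n x := by
  obtain ⟨i, hi⟩ := exists_lt_kthLargest hk hc
  filter_upwards [eventually_ge_atTop i] with n hn
  exact hi.trans_le (kthLargest_mono hk x (hn.trans (le_recordTime hk hx n)))

theorem apply_recordFn_zero_le {k : ℕ} (hk : 1 ≤ k) (x : ℕ → ℝ) {φ : ℝ → ℝ} (hφ : ∀ y, 0 ≤ φ y) :
    φ (recordFn k 0 x) ≤ ∑ j ∈ Finset.range k, φ (x j) := by
  obtain ⟨j, hj, h⟩ := exists_kthLargest_eq hk x 0
  have h' : recordFn k 0 x = x j := h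
  rw [h']
  exact Finset.single_le_sum (f := fun j => φ (x j)) (fun i _ => hφ (x i))
    (Finset.mem_range.2 (by omega))

/-! ### Measurability -/

theorem measurable_kthLargest {k : ℕ} (hk : 1 ≤ k) (i : ℕ) :
    Measurable fun x : ℕ → ℝ => kthLargest k x i := by
  refine measurable_of_Ioi fun c => ?_
  have : (fun x : ℕ → ℝ => kthLargest k x i) ⁻¹' Set.Ioi c =
      {x | k ≤ ∑ j ∈ Finset.range (i + k), if c < x j then 1 else 0} := by
    ext x
    simp only [Set.mem_preimage, Set.mem_Ioi, Set.mem_ofPred_eq, lt_kthLargest_iff hk,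
      Finset.card_filter]
  rw [this]
  refine measurableSet_le measurable_const (Finset.measurable_sum _ fun j _ => ?_)
  exact Measurable.ite (measurableSet_lt measurable_const (measurable_pi_apply j))
    measurable_const measurable_const

theorem measurable_kthLargest_comp {k : ℕ} (hk : 1 ≤ k) {T : (ℕ → ℝ) → ℕ} (hT : Measurable T) :
    Measurable fun x : ℕ → ℝ => kthLargest k x (T x) := by
  have h : Measurable fun p : ℕ × (ℕ → ℝ) => kthLargest k p.2 p.1 :=
    measurable_from_prod_countable_right fun i => measurable_kthLargest hk i
  exact h.comp (hT.prodMk measurable_id)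

theorem measurable_sInf_nat {α : Type*} [MeasurableSpace α] {s : α → Set ℕ}
    (hs : ∀ i, MeasurableSet {a | i ∈ s a}) : Measurable fun a => sInf (s a) := by
  classical
  have hne : MeasurableSet {a | ∃ i, i ∈ s a} := by
    simpa only [Set.ofPred_exists] using MeasurableSet.iUnion hs
  refine measurable_to_countable' fun m => ?_
  have : (fun a => sInf (s a)) ⁻¹' {m} =
      ({a | m ∈ s a} ∩ ⋂ i, ⋂ (_ : i < m), {a | i ∈ s a}ᶜ) ∪
        -- The infimum of the empty set is `0`.
        ({a | ∃ i, i ∈ s a}ᶜ ∩ {_a | m = 0}) := by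
    ext a
    simp only [Set.mem_preimage, Set.mem_singleton_iff, Set.mem_union, Set.mem_inter_iff,
      Set.mem_ofPred_eq, Set.mem_iInter, Set.mem_compl_iff]
    constructor
    · rintro rfl
      by_cases h : (s a).Nonempty
      · exact Or.inl ⟨Nat.sInf_mem h, fun i hi => Nat.notMem_of_lt_sInf hi⟩
      · refine Or.inr ⟨h, ?_⟩
        rw [Set.not_nonempty_iff_eq_empty.1 h, Nat.sInf_empty]
    · rintro (⟨h, h'⟩ | ⟨h, rfl⟩)
      · refine le_antisymm (Nat.sInf_le h) ?_
        by_contra hlt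
        exact h' _ (not_le.1 hlt) (Nat.sInf_mem ⟨m, h⟩)
      · have : s a = ∅ := Set.not_nonempty_iff_eq_empty.1 h
        rw [this, Nat.sInf_empty]
  rw [this]
  refine ((hs m).inter (MeasurableSet.iInter fun i => MeasurableSet.iInter fun _ =>
    (hs i).compl)).union (hne.compl.inter (MeasurableSet.const _))

theorem measurable_recordTime {k : ℕ} (hk : 1 ≤ k) (n : ℕ) :
    Measurable fun x : ℕ → ℝ => recordTime k x n := by
  induction n with
  | zero => exact measurable_const
  | succ n ih =>
    exact measurable_sInf_nat fun i =>
      measurableSet_lt (measurable_kthLargest_comp hk ih) (measurable_kthLargest hk i)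

theorem measurable_recordFn {k : ℕ} (hk : 1 ≤ k) (n : ℕ) : Measurable (recordFn k n) :=
  measurable_kthLargest_comp hk (measurable_recordTime hk n)

/-! ### The probability integral transform -/

/-- A nonempty sublevel set is a half-line `Iic b`, and continuity forces the cdf to equal `u` at
its endpoint `b`. -/
theorem measure_cdf_le {μ : Measure ℝ} [IsProbabilityMeasure μ]
    (hμ : Continuous fun x => cdf μ x) {u : ℝ} (h1 : u < 1) :
    μ {x | cdf μ x ≤ u} = ENNReal.ofReal u := by
  rcases Set.eq_empty_or_nonempty {x | cdf μ x ≤ u} with he | hne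
  · have : u ≤ 0 := by
      by_contra hu
      obtain ⟨x, hx⟩ := ((tendsto_cdf_atBot μ).eventually_lt_const (not_le.1 hu)).exists
      have : x ∈ {x | cdf μ x ≤ u} := hx.le
      simp [he] at this
    rw [he, measure_empty, ENNReal.ofReal_of_nonpos this]
  · obtain ⟨B, hB⟩ := ((tendsto_cdf_atTop μ).eventually_const_lt h1).exists
    have hbdd : BddAbove {x | cdf μ x ≤ u} :=
      ⟨B, fun x hx => ((monotone_cdf μ).reflect_lt (lt_of_le_of_lt hx hB)).le⟩
    have hclosed : IsClosed {x | cdf μ x ≤ u} := isClosed_le hμ continuous_const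
    have hb := hclosed.csSup_mem hne hbdd
    set b := sSup {x | cdf μ x ≤ u} with hbdef
    have hbu : cdf μ b = u := by
      refine le_antisymm hb (not_lt.1 fun hlt => ?_)
      have hev : ∀ᶠ y in 𝓝[>] b, cdf μ y < u :=
        ((hμ.tendsto b).eventually_lt_const hlt).filter_mono nhdsWithin_le_nhds
      obtain ⟨y, hy, hby⟩ := (hev.and self_mem_nhdsWithin).exists
      exact absurd (le_csSup hbdd (show y ∈ {x | cdf μ x ≤ u} from hy.le)) (not_le.2 hby)
    have : {x | cdf μ x ≤ u} = Set.Iic b := by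
      ext x
      exact ⟨fun hx => le_csSup hbdd hx, fun hx => (monotone_cdf μ hx).trans hb⟩
    rw [this, ← ofReal_cdf, hbu]

theorem map_cdf_eq {μ : Measure ℝ} [IsProbabilityMeasure μ]
    (hμ : Continuous fun x => cdf μ x) :
    μ.map (fun x => cdf μ x) = volume.restrict (Set.Icc (0 : ℝ) 1) := by
  have : IsProbabilityMeasure (μ.map fun x => cdf μ x) :=
    Measure.isProbabilityMeasure_map hμ.measurable.aemeasurable
  refine Measure.ext_of_Iic _ _ fun u => ?_
  rw [Measure.map_apply hμ.measurable measurableSet_Iic,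
    Measure.restrict_apply measurableSet_Iic]
  change μ {x | cdf μ x ≤ u} = _
  rcases lt_or_ge u 0 with h | h
  · have h1 : {x | cdf μ x ≤ u} = ∅ :=
      Set.eq_empty_of_forall_notMem fun x hx => absurd (h.trans_le (cdf_nonneg μ x)) (not_lt.2 hx)
    have h2 : Set.Iic u ∩ Set.Icc 0 1 = ∅ :=
      Set.eq_empty_of_forall_notMem fun x hx => absurd (h.trans_le hx.2.1) (not_lt.2 hx.1)
    rw [h1, h2, measure_empty, measure_empty]
  · rcases lt_or_ge u 1 with h' | h'
    · have h2 : Set.Iic u ∩ Set.Icc 0 1 = Set.Icc 0 u := by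
        ext x
        exact ⟨fun hx => ⟨hx.2.1, hx.1⟩, fun hx => ⟨hx.2, hx.1, hx.2.trans h'.le⟩⟩
      rw [h2, Real.volume_Icc, measure_cdf_le hμ h', sub_zero]
    · have h1 : {x | cdf μ x ≤ u} = Set.univ :=
        Set.eq_univ_of_forall fun x => (cdf_le_one μ x).trans h'
      have h2 : Set.Iic u ∩ Set.Icc 0 1 = Set.Icc 0 1 :=
        Set.inter_eq_right.2 fun x hx => hx.2.trans h'
      rw [h1, h2, measure_univ, Real.volume_Icc, sub_zero, ENNReal.ofReal_one]

theorem ae_cdf_ne {μ : Measure ℝ} [IsProbabilityMeasure μ]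
    (hμ : Continuous fun x => cdf μ x) (c : ℝ) : ∀ᵐ y ∂μ, cdf μ y ≠ c := by
  have h : ∀ᵐ u ∂(μ.map fun x => cdf μ x), u ≠ c := by
    rw [map_cdf_eq hμ]
    exact ae_restrict_of_ae (Measure.ae_ne volume c)
  exact ae_of_ae_map hμ.measurable.aemeasurable h

/-- If the cdf is constant on `[z, y]`, its value at `y` is also its value at a rational; these
countably many values are each taken with probability zero. -/
theorem ae_forall_cdf_lt {μ : Measure ℝ} [IsProbabilityMeasure μ]
    (hμ : Continuous fun x => cdf μ x) : ∀ᵐ y ∂μ, ∀ z < y, cdf μ z < cdf μ y := by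
  have h : ∀ᵐ y ∂μ, ∀ q : ℚ, cdf μ y ≠ cdf μ q := ae_all_iff.2 fun q => ae_cdf_ne hμ _
  filter_upwards [h] with y hy z hz
  obtain ⟨q, hzq, hqy⟩ := exists_rat_btwn hz
  exact (monotone_cdf μ hzq.le).trans_lt (lt_of_le_of_ne (monotone_cdf μ hqy.le) (hy q).symm)

/-! ### Records of an i.i.d. sequence with continuous distribution function -/

theorem measurable_recordValue {Ω : Type*} [MeasurableSpace Ω] {X : ℕ → Ω → ℝ} {k : ℕ} (hk : 1 ≤ k)
    (hX : ∀ i, Measurable (X i)) (n : ℕ) :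
    Measurable (recordValue k X n) :=
  (measurable_recordFn hk n).comp (measurable_pi_lambda _ hX)

theorem ae_all_of_law {Ω : Type*} [MeasurableSpace Ω] {P : Measure Ω} {μ : Measure ℝ}
    {X : ℕ → Ω → ℝ} (hX : ∀ i, Measurable (X i)) (hlaw : ∀ i, P.map (X i) = μ) {p : ℝ → Prop}
    (hp : ∀ᵐ y ∂μ, p y) : ∀ᵐ ω ∂P, ∀ i, p (X i ω) :=
  ae_all_iff.2 fun i => ae_of_ae_map (hX i).aemeasurable (by rwa [hlaw i])

section IID

variable {Ω : Type*} [MeasurableSpace Ω] {P : Measure Ω} [IsProbabilityMeasure P]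
  {μ : Measure ℝ} [IsProbabilityMeasure μ] {X : ℕ → Ω → ℝ}

/-- The distribution function of a record value depends on the observations only through their
distribution function, by a monotone transformation common to all continuous laws. -/
theorem distFun_recordValue {k : ℕ} (hk : 1 ≤ k) (hμ : Continuous fun x => cdf μ x)
    (hX : ∀ i, Measurable (X i)) (hind : iIndepFun X P) (hlaw : ∀ i, P.map (X i) = μ)
    (n : ℕ) (x : ℝ) :
    distFun P (recordValue k X n) x =
      (Measure.infinitePi fun _ : ℕ => volume.restrict (Set.Icc (0 : ℝ) 1)).real
        {u | recordFn k n u ≤ cdf μ x} := by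
  have hU : ∀ i, Measurable fun ω => cdf μ (X i ω) := fun i => hμ.measurable.comp (hX i)
  have hpi : P.map (fun ω i => cdf μ (X i ω)) =
      Measure.infinitePi fun _ : ℕ => volume.restrict (Set.Icc (0 : ℝ) 1) := by
    have h := (iIndepFun_iff_map_fun_eq_infinitePi_map hU).1
      (hind.comp (fun _ x => cdf μ x) fun _ => hμ.measurable)
    rw [h]
    congr 1
    funext i
    rw [← map_cdf_eq hμ, ← hlaw i, Measure.map_map (hlaw i ▸ hμ.measurable) (hX i)]
    rfl
  have hprob := Measure.isProbabilityMeasure_map (μ := P)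
    (measurable_recordValue hk hX n).aemeasurable
  rw [distFun, cdf_eq_real, map_measureReal_apply (measurable_recordValue hk hX n)
    measurableSet_Iic, ← hpi, map_measureReal_apply (measurable_pi_lambda _ hU)
    (measurableSet_le (measurable_recordFn hk n) measurable_const)]
  refine measureReal_congr ?_
  filter_upwards [ae_all_of_law hX hlaw (ae_forall_cdf_lt hμ)] with ω hω
  refine propext ?_
  change recordFn k n (fun i => X i ω) ≤ x ↔ recordFn k n (fun i => cdf μ (X i ω)) ≤ cdf μ x
  rw [recordFn_comp hk (monotone_cdf μ) hω]
  -- For the converse, the record is one of the observations, so the cdf increases strictly up to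
  -- it.
  refine ⟨fun h => monotone_cdf μ h, fun h => not_lt.1 fun hlt => ?_⟩
  obtain ⟨j, hj⟩ := exists_recordFn_eq hk n fun i => X i ω
  rw [hj] at hlt h
  exact absurd (hω j x hlt) (not_lt.2 h)

/-- Second Borel–Cantelli lemma for each rational level; continuity places a rational `q > c` with
cdf still below 1, so one null set serves all `c`. -/
theorem ae_frequently_lt (hμ : Continuous fun x => cdf μ x)
    (hX : ∀ i, Measurable (X i)) (hind : iIndepFun X P) (hlaw : ∀ i, P.map (X i) = μ) :
    ∀ᵐ ω ∂P, ∀ c, cdf μ c < 1 → ∃ᶠ l in atTop, c < X l ω := by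
  have key : ∀ q : ℚ, cdf μ q < 1 → ∀ᵐ ω ∂P, ∃ᶠ l in atTop, (q : ℝ) < X l ω := by
    intro q hq
    have hmeas : ∀ i, MeasurableSet (X i ⁻¹' Set.Ioi (q : ℝ)) := fun i => hX i measurableSet_Ioi
    have hset : iIndepSet (fun i => X i ⁻¹' Set.Ioi (q : ℝ)) P := by
      rw [iIndepSet_iff_meas_biInter hmeas]
      exact fun S => hind.measure_inter_preimage_eq_mul S fun _ _ => measurableSet_Ioi
    have hval : ∀ i, P (X i ⁻¹' Set.Ioi (q : ℝ)) = μ (Set.Ioi (q : ℝ)) := fun i => by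
      rw [← hlaw i, Measure.map_apply (hX i) measurableSet_Ioi]
    have hpos : μ (Set.Ioi (q : ℝ)) ≠ 0 := by
      intro h0
      have h := prob_compl_eq_one_sub (μ := μ) (measurableSet_Ioi (a := (q : ℝ)))
      rw [h0, Set.compl_Ioi, ← ofReal_cdf, tsub_zero, ENNReal.ofReal_eq_one] at h
      exact hq.ne h
    have h1 := measure_limsup_eq_one hmeas hset
      (by simp_rw [hval]; exact ENNReal.tsum_const_eq_top_of_ne_zero hpos)
    have h2 : ∀ᵐ ω ∂P, ω ∈ limsup (fun i => X i ⁻¹' Set.Ioi (q : ℝ)) atTop :=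
      (mem_ae_iff_prob_eq_one (MeasurableSet.measurableSet_limsup hmeas)).2 h1
    filter_upwards [h2] with ω hω
    exact mem_limsup_iff_frequently_mem.1 hω
  have key' : ∀ᵐ ω ∂P, ∀ q : ℚ, cdf μ q < 1 → ∃ᶠ l in atTop, (q : ℝ) < X l ω :=
    ae_all_iff.2 fun q => by
      by_cases hq : cdf μ q < 1
      · filter_upwards [key q hq] with ω hω _ using hω
      · exact Eventually.of_forall fun ω h => absurd h hq
  filter_upwards [key'] with ω hω c hc
  have hev : ∀ᶠ y in 𝓝[>] c, cdf μ y < 1 :=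
    ((hμ.tendsto c).eventually_lt_const hc).filter_mono nhdsWithin_le_nhds
  obtain ⟨y, hy, hcy⟩ := (hev.and self_mem_nhdsWithin).exists
  obtain ⟨q, hcq, hqy⟩ := exists_rat_btwn hcy
  exact (hω q ((monotone_cdf μ hqy.le).trans_lt hy)).mono fun l hl => hcq.trans hl

theorem ae_eventually_lt_recordValue {k : ℕ} (hk : 1 ≤ k) (hμ : Continuous fun x => cdf μ x)
    (hX : ∀ i, Measurable (X i)) (hind : iIndepFun X P) (hlaw : ∀ i, P.map (X i) = μ)
    {c : ℝ} (hc : cdf μ c < 1) : ∀ᵐ ω ∂P, ∀ᶠ n in atTop, c < recordValue k X n ω := by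
  filter_upwards [ae_frequently_lt hμ hX hind hlaw, ae_all_of_law hX hlaw (ae_cdf_ne hμ 1)]
    with ω hω hne
  exact eventually_lt_recordFn hk
    (fun j => hω _ (lt_of_le_of_ne (cdf_le_one μ _) (hne j))) (hω c hc)

theorem tendsto_lintegral_recordValue {k : ℕ} (hk : 1 ≤ k) (hμ : Continuous fun x => cdf μ x)
    (hX : ∀ i, Measurable (X i)) (hind : iIndepFun X P) (hlaw : ∀ i, P.map (X i) = μ)
    {c : ℝ} (hc : cdf μ c < 1) {φ g : ℝ → ℝ} {C : ℝ} (hφ0 : ∀ y, 0 ≤ φ y) (hφ : Integrable φ μ)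
    (hg : Measurable g) (hgc : ∀ y, c < y → g y = 0) (hgφ : ∀ z y, z ≤ y → g y ≤ C + φ z) :
    Tendsto (fun n => ∫⁻ y, ENNReal.ofReal (g y) ∂(P.map (recordValue k X n))) atTop (𝓝 0) := by
  have hmap : ∀ n, ∫⁻ y, ENNReal.ofReal (g y) ∂(P.map (recordValue k X n)) =
      ∫⁻ ω, ENNReal.ofReal (g (recordValue k X n ω)) ∂P := fun n =>
    lintegral_map hg.ennreal_ofReal (measurable_recordValue hk hX n)
  simp_rw [hmap]
  rw [show (0 : ENNReal) = ∫⁻ _, 0 ∂P by simp]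
  have hint : Integrable (fun ω => C + ∑ j ∈ Finset.range k, φ (X j ω)) P := by
    refine (integrable_const C).add (integrable_finsetSum _ fun j _ => ?_)
    have : Integrable φ (P.map (X j)) := by rwa [hlaw j]
    exact this.comp_measurable (hX j)
  refine tendsto_lintegral_of_dominated_convergence
    (fun ω => ENNReal.ofReal (C + ∑ j ∈ Finset.range k, φ (X j ω)))
    (fun n => (hg.comp (measurable_recordValue hk hX n)).ennreal_ofReal)
    (fun n => Eventually.of_forall fun ω => ENNReal.ofReal_le_ofReal ?_)
    hint.lintegral_lt_top.ne ?_
  · exact (hgφ _ _ (recordFn_zero_le hk n fun i => X i ω)).trans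
      (add_le_add_right (apply_recordFn_zero_le hk _ hφ0) C)
  · filter_upwards [ae_eventually_lt_recordValue hk hμ hX hind hlaw hc] with ω hω
    refine tendsto_const_nhds.congr' ?_
    filter_upwards [hω] with n hn
    rw [hgc _ hn, ENNReal.ofReal_zero]

end IID

/-! ### Quantile functions -/

/-- Right-continuity of the cdf makes the infimum attained. -/
theorem quantile_cdf_le_iff (ρ : Measure ℝ) {u : ℝ} (hu : u ∈ Set.Ioo (0 : ℝ) 1) (x : ℝ) :
    quantile (cdf ρ) u ≤ x ↔ u ≤ cdf ρ x := by
  obtain ⟨A, hA⟩ := ((tendsto_cdf_atBot ρ).eventually_lt_const hu.1).exists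
  obtain ⟨B, hB⟩ := ((tendsto_cdf_atTop ρ).eventually_const_lt hu.2).exists
  have hbdd : BddBelow {x | u ≤ cdf ρ x} :=
    ⟨A, fun y hy => ((monotone_cdf ρ).reflect_lt (lt_of_lt_of_le hA hy)).le⟩
  have hne : {x | u ≤ cdf ρ x}.Nonempty := ⟨B, hB.le⟩
  refine ⟨fun h => ?_, fun h => csInf_le hbdd h⟩
  refine ge_of_tendsto (((cdf ρ).right_continuous x).tendsto.mono_left
    (nhdsWithin_mono x Set.Ioi_subset_Ici_self)) ?_
  filter_upwards [self_mem_nhdsWithin] with y hy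
  obtain ⟨z, hz, hzy⟩ := exists_lt_of_csInf_lt hne (lt_of_le_of_lt h hy)
  exact le_trans hz (monotone_cdf ρ hzy.le)

theorem aemeasurable_quantile_cdf (ρ : Measure ℝ) :
    AEMeasurable (quantile (cdf ρ)) (volume.restrict (Set.Ioo (0 : ℝ) 1)) :=
  aemeasurable_restrict_of_monotoneOn measurableSet_Ioo fun _ hu _ hv huv =>
    (quantile_cdf_le_iff ρ hu _).2 (huv.trans ((quantile_cdf_le_iff ρ hv _).1 le_rfl))

theorem map_quantile_cdf (ρ : Measure ℝ) [IsProbabilityMeasure ρ] :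
    (volume.restrict (Set.Ioo (0 : ℝ) 1)).map (quantile (cdf ρ)) = ρ := by
  have : IsFiniteMeasure (volume.restrict (Set.Ioo (0 : ℝ) 1)) := ⟨by simp⟩
  refine Measure.ext_of_Iic _ _ fun x => ?_
  rw [Measure.map_apply_of_aemeasurable (aemeasurable_quantile_cdf ρ) measurableSet_Iic,
    ← ofReal_cdf]
  have h : quantile (cdf ρ) ⁻¹' Set.Iic x =ᵐ[volume.restrict (Set.Ioo (0 : ℝ) 1)]
      Set.Iic (cdf ρ x) := by
    filter_upwards [ae_restrict_mem measurableSet_Ioo] with u hu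
    exact propext (quantile_cdf_le_iff ρ hu x)
  rw [measure_congr h, Measure.restrict_congr_set Ioo_ae_eq_Ioc,
    Measure.restrict_apply measurableSet_Iic]
  have h2 : Set.Iic (cdf ρ x) ∩ Set.Ioc 0 1 = Set.Ioc 0 (cdf ρ x) := by
    ext u
    exact ⟨fun hu => ⟨hu.2.1, hu.1⟩, fun hu => ⟨hu.2, hu.1, hu.2.trans (cdf_le_one ρ x)⟩⟩
  rw [h2, Real.volume_Ioc, sub_zero]

theorem lintegral_quantile_cdf (ρ : Measure ℝ) [IsProbabilityMeasure ρ] {f : ℝ → ENNReal}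
    (hf : Measurable f) :
    ∫⁻ u in Set.Ioo (0 : ℝ) 1, f (quantile (cdf ρ) u) = ∫⁻ y, f y ∂ρ := by
  conv_rhs => rw [← map_quantile_cdf ρ]
  rw [lintegral_map' hf.aemeasurable (aemeasurable_quantile_cdf ρ)]

theorem measurableSet_quantile_lt (ρ σ : Measure ℝ) :
    MeasurableSet {u : ℝ | u ∈ Set.Ioo (0 : ℝ) 1 ∧ quantile (cdf σ) u < quantile (cdf ρ) u} := by
  have : {u : ℝ | u ∈ Set.Ioo (0 : ℝ) 1 ∧ quantile (cdf σ) u < quantile (cdf ρ) u} =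
      ⋃ q : ℚ, Set.Ioo (0 : ℝ) 1 ∩ (Set.Iic (cdf σ q) ∩ Set.Ioi (cdf ρ q)) := by
    ext u
    simp only [Set.mem_ofPred_eq, Set.mem_iUnion, Set.mem_inter_iff, Set.mem_Iic, Set.mem_Ioi]
    constructor
    · rintro ⟨hu, hlt⟩
      obtain ⟨q, h1, h2⟩ := exists_rat_btwn hlt
      exact ⟨q, hu, (quantile_cdf_le_iff σ hu q).1 h1.le,
        not_le.1 fun h => absurd ((quantile_cdf_le_iff ρ hu q).2 h) (not_le.2 h2)⟩
    · rintro ⟨q, hu, h1, h2⟩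
      exact ⟨hu, ((quantile_cdf_le_iff σ hu q).2 h1).trans_lt
        (not_le.1 fun h => absurd ((quantile_cdf_le_iff ρ hu q).1 h) (not_le.2 h2))⟩
  rw [this]
  exact MeasurableSet.iUnion fun q =>
    measurableSet_Ioo.inter (measurableSet_Iic.inter measurableSet_Ioi)

/-! ### Bounds for the two integrals when the distribution functions are ordered on a half-line -/

/-- Tonelli on the region `y ≤ x < d`. -/
theorem lintegral_cdf_Iio (ρ : Measure ℝ) [IsProbabilityMeasure ρ] (d : ℝ) :
    ∫⁻ x in Set.Iio d, ENNReal.ofReal (cdf ρ x) = ∫⁻ y, ENNReal.ofReal (d - y) ∂ρ := by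
  have h1 : ∀ x, ENNReal.ofReal (cdf ρ x) =
      ∫⁻ y, {p : ℝ × ℝ | p.2 ≤ p.1}.indicator (fun _ => (1 : ENNReal)) (x, y) ∂ρ := fun x => by
    rw [ofReal_cdf, ← lintegral_indicator_one measurableSet_Iic]
    rfl
  have hm : Measurable ({p : ℝ × ℝ | p.2 ≤ p.1}.indicator fun _ => (1 : ENNReal)) :=
    measurable_const.indicator (measurableSet_le measurable_snd measurable_fst)
  simp_rw [h1]
  rw [lintegral_lintegral_swap
    (f := fun x y => {p : ℝ × ℝ | p.2 ≤ p.1}.indicator (fun _ => (1 : ENNReal)) (x, y))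
    hm.aemeasurable]
  refine lintegral_congr fun y => ?_
  have h2 : (fun x => {p : ℝ × ℝ | p.2 ≤ p.1}.indicator (fun _ => (1 : ENNReal)) (x, y)) =
      (Set.Ici y).indicator 1 := rfl
  rw [h2, lintegral_indicator_one measurableSet_Ici, Measure.restrict_apply measurableSet_Ici,
    Set.Ici_inter_Iio, Real.volume_Ico]

theorem setLIntegral_cdf_sub_le (ρ σ : Measure ℝ) [IsProbabilityMeasure σ] {d : ℝ}
    (h : ∀ x, d ≤ x → cdf σ x ≤ cdf ρ x) :
    ∫⁻ x in {x : ℝ | cdf ρ x < cdf σ x}, ENNReal.ofReal |cdf ρ x - cdf σ x| ≤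
      ∫⁻ y, ENNReal.ofReal (d - y) ∂σ := by
  rw [← lintegral_cdf_Iio]
  have hsub : {x : ℝ | cdf ρ x < cdf σ x} ⊆ Set.Iio d := fun x hx =>
    not_le.1 fun hdx => absurd (h x hdx) (not_le.2 hx)
  refine le_trans (setLIntegral_mono' (measurableSet_lt (monotone_cdf ρ).measurable
    (monotone_cdf σ).measurable) fun x hx => ENNReal.ofReal_le_ofReal ?_)
    (lintegral_mono_set hsub)
  rw [abs_sub_comm, abs_of_pos (sub_pos.2 hx)]
  linarith [cdf_nonneg ρ x]

theorem setLIntegral_quantile_sub_le (ρ σ : Measure ℝ) [IsProbabilityMeasure ρ]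
    [IsProbabilityMeasure σ] {d d' : ℝ} (h : ∀ x, d ≤ x → cdf σ x ≤ cdf ρ x)
    (hd : cdf σ d ≤ cdf ρ d') :
    ∫⁻ u in {u : ℝ | u ∈ Set.Ioo (0 : ℝ) 1 ∧ quantile (cdf σ) u < quantile (cdf ρ) u},
        ENNReal.ofReal ((quantile (cdf ρ) u - quantile (cdf σ) u) ^ 2) ≤
      2 * (∫⁻ y, ENNReal.ofReal ((Set.Iic d').indicator (fun y => y ^ 2) y) ∂ρ +
        ∫⁻ y, ENNReal.ofReal ((Set.Iic d).indicator (fun y => y ^ 2) y) ∂σ) := by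
  have hm : ∀ c : ℝ, Measurable fun y : ℝ =>
      ENNReal.ofReal ((Set.Iic c).indicator (fun y => y ^ 2) y) := fun c =>
    ((measurable_id.pow_const 2).indicator measurableSet_Iic).ennreal_ofReal
  have hq : AEMeasurable (fun u => ENNReal.ofReal
      ((Set.Iic d').indicator (fun y => y ^ 2) (quantile (cdf ρ) u)))
      (volume.restrict (Set.Ioo (0 : ℝ) 1)) :=
    (hm d').comp_aemeasurable (aemeasurable_quantile_cdf ρ)
  rw [← lintegral_quantile_cdf ρ (hm d'), ← lintegral_quantile_cdf σ (hm d),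
    ← lintegral_add_left' hq,
    ← lintegral_const_mul' _ _ (by simp)]
  refine le_trans (setLIntegral_mono' (measurableSet_quantile_lt ρ σ) ?_)
    (lintegral_mono_set fun u hu => hu.1)
  rintro u ⟨hu, hlt⟩
  -- Otherwise the `σ`-quantile exceeds `d`, where the order of the cdfs forces the opposite order
  -- of the quantiles.
  have hud : u ≤ cdf σ d := by
    by_contra hcon
    have hq : d < quantile (cdf σ) u :=
      not_le.1 fun hle => hcon ((quantile_cdf_le_iff σ hu d).1 hle)
    refine absurd ((quantile_cdf_le_iff ρ hu _).2 ?_) (not_le.2 hlt)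
    exact ((quantile_cdf_le_iff σ hu _).1 le_rfl).trans (h _ hq.le)
  rw [Set.indicator_of_mem (Set.mem_Iic.2 ((quantile_cdf_le_iff σ hu d).2 hud)),
    Set.indicator_of_mem (Set.mem_Iic.2 ((quantile_cdf_le_iff ρ hu d').2 (hud.trans hd))),
    ← ENNReal.ofReal_add (sq_nonneg _) (sq_nonneg _),
    show (2 : ENNReal) = ENNReal.ofReal 2 by simp, ← ENNReal.ofReal_mul zero_le_two]
  refine ENNReal.ofReal_le_ofReal ?_
  nlinarith [sq_nonneg (quantile (cdf ρ) u + quantile (cdf σ) u)]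

theorem indicator_Iic_sq_le (c : ℝ) {z y : ℝ} (h : z ≤ y) :
    (Set.Iic c).indicator (fun y => y ^ 2) y ≤ c ^ 2 + z ^ 2 := by
  by_cases hy : y ≤ c
  · rw [Set.indicator_of_mem (Set.mem_Iic.2 hy)]
    -- Either `0 ≤ y ≤ c`, so `y² ≤ c²`, or `z ≤ y ≤ 0`, so `y² ≤ z²`.
    rcases le_total 0 y with h0 | h0
    · nlinarith [sq_nonneg z]
    · nlinarith [sq_nonneg c]
  · rw [Set.indicator_of_notMem (by simpa using hy)]
    positivity

end AsymptoticOrder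

end

theorem mainTheorem12
    {Ω Ω' : Type*} [MeasurableSpace Ω] [MeasurableSpace Ω']
    (P : Measure Ω) [IsProbabilityMeasure P] (Q : Measure Ω') [IsProbabilityMeasure Q]
    (μ ν : Measure ℝ) [IsProbabilityMeasure μ] [IsProbabilityMeasure ν]
    (hμ : Continuous (fun x => cdf μ x)) (hν : Continuous (fun x => cdf ν x))
    (hdom : ∃ d : ℝ, cdf ν d < 1 ∧ ∀ x : ℝ, d ≤ x → cdf ν x ≤ cdf μ x)
    (X : ℕ → Ω → ℝ) (Y : ℕ → Ω' → ℝ)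
    (hXmeas : ∀ i, Measurable (X i)) (hYmeas : ∀ i, Measurable (Y i))
    (hXindep : iIndepFun X P) (hYindep : iIndepFun Y Q)
    (hXlaw : ∀ i, P.map (X i) = μ) (hYlaw : ∀ i, Q.map (Y i) = ν) :
    (Integrable (fun x : ℝ => x) μ → Integrable (fun x : ℝ => x) ν →
      ∀ k : ℕ, 1 ≤ k →
        AsymptoticOrder.L1AstLE P (AsymptoticOrder.recordValue k X)
          Q (AsymptoticOrder.recordValue k Y)) ∧
    (Integrable (fun x : ℝ => x ^ 2) μ → Integrable (fun x : ℝ => x ^ 2) ν →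
      ∀ k : ℕ, 1 ≤ k →
        AsymptoticOrder.W2AstLE P (AsymptoticOrder.recordValue k X)
          Q (AsymptoticOrder.recordValue k Y)) := by
  open AsymptoticOrder in
  obtain ⟨d, hd1, hd⟩ := hdom
  -- Both sides are values of the same monotone `G_n`. Distinct points `x`, `y` are allowed so that
  -- the pair `d`, `d'` is covered.
  have hle : ∀ {k : ℕ}, 1 ≤ k → ∀ (n : ℕ) {x y : ℝ}, cdf ν x ≤ cdf μ y →
      cdf (Q.map (recordValue k Y n)) x ≤ cdf (P.map (recordValue k X n)) y := by
    intro k hk n x y hxy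
    have hX := distFun_recordValue hk hμ hXmeas hXindep hXlaw n y
    have hY := distFun_recordValue hk hν hYmeas hYindep hYlaw n x
    rw [distFun] at hX hY
    rw [hX, hY]
    have : IsProbabilityMeasure (volume.restrict (Set.Icc (0 : ℝ) 1)) := ⟨by simp⟩
    exact measureReal_mono fun u hu => le_trans hu hxy
  have hPprob : ∀ {k : ℕ}, 1 ≤ k → ∀ n, IsProbabilityMeasure (P.map (recordValue k X n)) :=
    fun hk n => Measure.isProbabilityMeasure_map (measurable_recordValue hk hXmeas n).aemeasurable
  have hQprob : ∀ {k : ℕ}, 1 ≤ k → ∀ n, IsProbabilityMeasure (Q.map (recordValue k Y n)) :=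
    fun hk n => Measure.isProbabilityMeasure_map (measurable_recordValue hk hYmeas n).aemeasurable
  refine ⟨fun _ hν1 k hk => ?_, fun hμ2 hν2 k hk => ?_⟩
  · have hlim := tendsto_lintegral_recordValue hk hν hYmeas hYindep hYlaw hd1
      (φ := fun y => |y|) (g := fun y => max (d - y) 0) (C := |d|) (fun y => abs_nonneg y)
      hν1.abs ((measurable_const.sub measurable_id).max measurable_const)
      (fun y hy => max_eq_right (by linarith))
      (fun z y hzy => max_le (by linarith [le_abs_self d, neg_abs_le z]) (by positivity))
    refine tendsto_of_tendsto_of_tendsto_of_le_of_le tendsto_const_nhds hlim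
      (fun n => zero_le) fun n => ?_
    have := hQprob hk n
    refine (setLIntegral_cdf_sub_le _ _ fun x hx => hle hk n (hd x hx)).trans ?_
    exact lintegral_mono fun y => ENNReal.ofReal_le_ofReal (le_max_left _ _)
  -- Intermediate value theorem for the cdf of `μ`, at a level `v` strictly between `cdf ν d` and 1.
  · obtain ⟨d', hdd', hd'1⟩ : ∃ d', cdf ν d ≤ cdf μ d' ∧ cdf μ d' < 1 := by
      obtain ⟨v, hv, hv1⟩ := exists_between hd1
      obtain ⟨A, hA⟩ := ((tendsto_cdf_atBot μ).eventually_lt_const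
        ((cdf_nonneg ν d).trans_lt hv)).exists
      obtain ⟨B, hB⟩ := ((tendsto_cdf_atTop μ).eventually_const_lt hv1).exists
      obtain ⟨d', hd'⟩ := mem_range_of_exists_le_of_exists_ge hμ ⟨A, hA.le⟩ ⟨B, hB.le⟩
      exact ⟨d', hv.le.trans_eq hd'.symm, hd'.trans_lt hv1⟩
    have hX := tendsto_lintegral_recordValue hk hμ hXmeas hXindep hXlaw hd'1
      (φ := fun y => y ^ 2) (g := (Set.Iic d').indicator fun y => y ^ 2) (C := d' ^ 2)
      (fun y => sq_nonneg y) hμ2 ((measurable_id.pow_const 2).indicator measurableSet_Iic)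
      (fun y hy => Set.indicator_of_notMem (by simpa using hy) _)
      (fun z y hzy => indicator_Iic_sq_le d' hzy)
    have hY := tendsto_lintegral_recordValue hk hν hYmeas hYindep hYlaw hd1
      (φ := fun y => y ^ 2) (g := (Set.Iic d).indicator fun y => y ^ 2) (C := d ^ 2)
      (fun y => sq_nonneg y) hν2 ((measurable_id.pow_const 2).indicator measurableSet_Iic)
      (fun y hy => Set.indicator_of_notMem (by simpa using hy) _)
      (fun z y hzy => indicator_Iic_sq_le d hzy)
    have hlim := ENNReal.Tendsto.const_mul (a := 2) (hX.add hY) (Or.inr (by simp))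
    rw [add_zero, mul_zero] at hlim
    refine tendsto_of_tendsto_of_tendsto_of_le_of_le tendsto_const_nhds hlim
      (fun n => zero_le) fun n => ?_
    have := hPprob hk n
    have := hQprob hk n
    exact setLIntegral_quantile_sub_le _ _ (fun x hx => hle hk n (hd x hx)) (hle hk n hdd')
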